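/- Let $g:\mathbb{N}\to\mathbb{R}$ be a decreasing function, i.e. $g(0)=0$ and $g$ is nonnegative and nonincreasing on $\{1,2,\dots\}$, and suppose $g(1)>0$. For $f\in\mathbb{N}^n$ put $\mathrm{supp}(f)=\{d: f_d\ne 0\}$ and $g(f)=\sum_{d\in\mathrm{supp}(f)}g(f_d)$, and let $$\sigma=\sigma(\epsilon,g,m,n)=\max\Big\{|\mathrm{supp}(f)| : f\in\mathbb{N}^n,\ \sum_d f_d\le m,\ g(f)\le\epsilon^{-1}g(1)\Big\}.$$ An insertion-only stream is a finite (possibly empty) sequence of items $d\in\{1,\dots,n\}$; its frequency vector $f$ counts the occurrences of each item, and it is valid if $\sum_d f_d\le m$. A $k$-pass insertion-only streaming $(1\pm\epsilon)$-approximation algorithm for $g(f)$ is a randomized algorithm that reads the stream $k$ times in order, one item at a time, and for every valid stream outputs, from its final memory, a number in $[(1-\epsilon)g(f),(1+\epsilon)g(f)]$ with probability at least $2/3$. Its space is the maximum number of bits in its memory, over all valid streams and all outcomes of its randomness. For every $\epsilon_0<1$ there is a constant $c>0$, depending only on $\epsilon_0$, such that for all $n,m\in\mathbb{N}$, $k\ge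 1$, $0<\epsilon\le\epsilon_0$ and all such $g$, every $k$-pass insertion-only streaming $(1\pm\epsilon)$-approximation algorithm for $g(f)$ uses at least $c\,\sigma/k$ bits of space. (In particular, for $\epsilon\in(0,1/2]$ the constant is universal.) -/

import Mathlib

namespace Streaming

/-- A *decreasing function*: `g 0 = 0`, and `g` is nonnegative and nonincreasing from `1` on. -/
structure IsDecreasingFun (g : ℕ → ℝ) : Prop where
  zero : g 0 = 0
  nonneg : ∀ x, 1 ≤ x → 0 ≤ g x
  anti : ∀ x y, 1 ≤ x → x ≤ y → g y ≤ g x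

/-- The support of a (nonnegative) frequency vector. -/
def supp {n : ℕ} (f : Fin n → ℕ) : Finset (Fin n) :=
  Finset.univ.filter fun d => f d ≠ 0

/-- The sum `g(f) = ∑_{d ∈ supp f} g(f_d)`. -/
def sumOn {n : ℕ} (g : ℕ → ℝ) (f : Fin n → ℕ) : ℝ :=
  ∑ d ∈ supp f, g (f d)

/-- The nonnegative frequency vectors of dimension `n` and `L¹` norm at most `m`. -/
def freqVectors (n m : ℕ) : Set (Fin n → ℕ) :=
  {f | ∑ d, f d ≤ m}

/-- The values of `|supp f|` over the `f` of `L¹` norm at most `m` with `g(f) ≤ ε⁻¹ g(1)`. -/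
def feasibleSizes (ε : ℝ) (g : ℕ → ℝ) (m n : ℕ) : Set ℕ :=
  {s | ∃ f ∈ freqVectors n m, sumOn g f ≤ ε⁻¹ * g 1 ∧ (supp f).card = s}

/-- The parameter `σ(ε, g, m, n)`, the largest feasible support size. -/
noncomputable def sigma (ε : ℝ) (g : ℕ → ℝ) (m n : ℕ) : ℕ :=
  sSup (feasibleSizes ε g m n)

/-- The maximum that defines `sigma` is attained (by some vector). -/
theorem sigma_isGreatest {ε : ℝ} {g : ℕ → ℝ} (hg : IsDecreasingFun g) (hε : 0 < ε) (m n : ℕ) :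
    IsGreatest (feasibleSizes ε g m n) (sigma ε g m n) := by
  have hb : BddAbove (feasibleSizes ε g m n) := by
    refine ⟨n, ?_⟩
    rintro s ⟨f, -, -, rfl⟩
    simpa using Finset.card_le_univ (supp f)
  have hne : (feasibleSizes ε g m n).Nonempty := by
    refine ⟨0, fun _ => 0, by simp [freqVectors], ?_, by simp [supp]⟩
    have := mul_nonneg (inv_nonneg.mpr hε.le) (hg.nonneg 1 le_rfl)
    simpa [sumOn, supp] using this
  exact ⟨Nat.sSup_mem hne hb, fun s hs => le_csSup hb hs⟩

/-- The frequency vector of an insertion-only stream. Every update of such a stream adds `1` to a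
coordinate, so the stream is given by the list of the items that it updates. -/
def freq {n : ℕ} (S : List (Fin n)) : Fin n → ℕ := fun d => S.count d

/-- The valid insertion-only streams: those with frequency vector of `L¹` norm at most `m`. -/
def insertionStreams (n m : ℕ) : Set (List (Fin n)) :=
  {S | freq S ∈ freqVectors n m}

/-- A randomized multi-pass streaming algorithm over the items `Fin n`. Its memory is a bit string,
`Ω` is the sample space of its random tape. The update rule may be nonuniform and uncomputable; it
may consult, at no cost, the whole random tape (so in particular coins that are tossed afresh at
every step), the number `p` of the current pass and the number `i` of tokens read before in that
pass. What it knows about the stream is otherwise in its memory, from which alone (and the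
random tape) the output is computed. -/
structure Algorithm (Ω : Type*) [MeasurableSpace Ω] (n : ℕ) where
  /-- the initial memory -/
  init : Ω → List Bool
  /-- `step ω p i s d`: the new memory if the memory is `s` when token number `i` of pass `p`,
  the item `d`, is read -/
  step : Ω → ℕ → ℕ → List Bool → Fin n → List Bool
  /-- `endPass ω p s`: the new memory if the memory is `s` when pass `p` ends -/
  endPass : Ω → ℕ → List Bool → List Bool
  /-- the output, from the final memory -/
  out : Ω → List Bool → ℝ
  measurable_init : ∀ t, MeasurableSet {ω | init ω = t}
  measurable_step : ∀ p i s d t, MeasurableSet {ω | step ω p i s d = t}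
  measurable_endPass : ∀ p s t, MeasurableSet {ω | endPass ω p s = t}
  measurable_out : ∀ s, Measurable fun ω => out ω s

namespace Algorithm

variable {Ω : Type*} [MeasurableSpace Ω] {n : ℕ}

/-- The memory after reading a list of tokens in pass `p`, of which the first has number `i`,
from the memory `s`. -/
def read (A : Algorithm Ω n) (ω : Ω) (p : ℕ) : ℕ → List Bool → List (Fin n) → List Bool
  | _, s, [] => s
  | i, s, d :: l => A.read ω p (i + 1) (A.step ω p i s d) l

/-- The memory after `p` complete passes over the stream `S`. -/
def afterPasses (A : Algorithm Ω n) (ω : Ω) (S : List (Fin n)) : ℕ → List Bool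
  | 0 => A.init ω
  | p + 1 => A.endPass ω p (A.read ω p 0 (A.afterPasses ω S p) S)

/-- The output after `k` passes over the stream `S`. -/
def output (A : Algorithm Ω n) (k : ℕ) (ω : Ω) (S : List (Fin n)) : ℝ :=
  A.out ω (A.afterPasses ω S k)

/-- With `k` passes, the algorithm never has more than `b` bits in its memory, whatever the valid
stream and the outcome of the randomness. -/
def UsesAtMost (A : Algorithm Ω n) (k m b : ℕ) : Prop :=
  ∀ S ∈ insertionStreams n m, ∀ ω : Ω,
    (∀ p < k, ∀ i ≤ S.length,
      (A.read ω p 0 (A.afterPasses ω S p) (S.take i)).length ≤ b) ∧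
    (A.afterPasses ω S k).length ≤ b

/-- With `k` passes, the algorithm is an insertion-only streaming `(1 ± ε)`-approximation algorithm
for `g(f)`: on every valid stream, its output is correct with probability at least `2/3`. -/
def IsApprox (A : Algorithm Ω n) (μ : MeasureTheory.Measure Ω) (k m : ℕ) (g : ℕ → ℝ)
    (ε : ℝ) : Prop :=
  ∀ S ∈ insertionStreams n m,
    2 / 3 ≤ μ.real {ω | (1 - ε) * sumOn g (freq S) ≤ A.output k ω S ∧
      A.output k ω S ≤ (1 + ε) * sumOn g (freq S)}

end Algorithm

end Streaming

open scoped BigOperators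

namespace Streaming
section Corruption

variable {ι : Type*} [DecidableEq ι]

/-- The bits of `z` that are selected by `D`. -/
def mask (D z : ι → Bool) : ι → Bool := fun i => D i && z i

theorem mask_update (D z : ι → Bool) (j : ι) (v : Bool) (hD : D j = true) :
    mask D (Function.update z j v) = Function.update (mask D z) j v := by
  ext i
  by_cases h : i = j
  · subst h; simp [mask, hD]
  · simp [mask, h]

/-- The complement of a set of coordinates. -/
def compl (D : ι → Bool) : ι → Bool := fun i => !D i

theorem compl_update (D : ι → Bool) (j : ι) (v : Bool) :
    compl (Function.update D j v) = Function.update (compl D) j (!v) := by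
  ext i
  by_cases h : i = j
  · subst h; simp [compl]
  · simp [compl, h]

variable [Fintype ι]

/-- The sign `±1` of a bit. -/
def bitSign (v : Bool) : ℝ := if v then 1 else -1

/-- Splitting an average over the cube along one coordinate. -/
theorem expect_cube_split (F : (ι → Bool) → ℝ) (j : ι) :
    𝔼 z, F z = (𝔼 z, F (Function.update z j true) + 𝔼 z, F (Function.update z j false)) / 2 := by
  have hflip : 𝔼 z, F z = 𝔼 z : ι → Bool, F (Function.update z j (!z j)) := by
    refine Fintype.expect_bijective (fun z : ι → Bool => Function.update z j (!z j)) ?_ _ _ ?_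
    · refine Function.Involutive.bijective fun z => ?_
      simp
    · intro z
      simp
  have hpt : ∀ z : ι → Bool, F z + F (Function.update z j (!z j)) =
      F (Function.update z j true) + F (Function.update z j false) := by
    intro z
    have h1 : Function.update z j (z j) = z := Function.update_eq_self j z
    cases h : z j with
    | true => rw [h] at h1; simp [h1]
    | false => rw [h] at h1; simp [h1, add_comm]
  have : 𝔼 z, F z + 𝔼 z, F z =
      𝔼 z, F (Function.update z j true) + 𝔼 z, F (Function.update z j false) := by
    conv_lhs => rw [hflip]
    conv_lhs => arg 1; rw [← hflip]
    rw [← Finset.expect_add_distrib, ← Finset.expect_add_distrib]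
    exact Finset.expect_congr rfl fun z _ => hpt z
  linarith

/-- The moment generating function of a Rademacher sum is sub-Gaussian. -/
theorem expect_exp_bitSign_le (s : ι → ℝ) :
    𝔼 z : ι → Bool, Real.exp (∑ j, s j * bitSign (z j)) ≤ Real.exp ((∑ j, s j ^ 2) / 2) := by
  have h1 : ∑ z : ι → Bool, Real.exp (∑ j, s j * bitSign (z j)) =
      ∏ j, (2 * Real.cosh (s j)) := by
    have := Finset.prod_univ_sum (fun _ : ι => (Finset.univ : Finset Bool))
      (fun j v => Real.exp (s j * bitSign v))
    rw [Fintype.piFinset_univ] at this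
    simp_rw [Real.exp_sum]
    rw [← this]
    refine Finset.prod_congr rfl fun j _ => ?_
    rw [Real.cosh_eq]
    simp [bitSign]
    ring
  rw [Fintype.expect_eq_sum_div_card, h1, Finset.prod_mul_distrib]
  simp only [Finset.prod_const, Finset.card_univ, Fintype.card_pi, Fintype.card_bool]
  push_cast
  rw [mul_div_cancel_left₀ _ (by positivity), Finset.sum_div, Real.exp_sum]
  exact Finset.prod_le_prod (fun j _ => (Real.cosh_pos _).le)
    fun j _ => Real.cosh_le_exp_half_sq _

/-- A `[0,1]`-valued function on the cube that is noticeably correlated with many coordinates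
has exponentially small average. -/
theorem expect_le_exp_of_biased (φ : (ι → Bool) → ℝ) (h0 : ∀ z, 0 ≤ φ z) (h1 : ∀ z, φ z ≤ 1)
    (J : Finset ι) (hJ : ∀ j ∈ J, (𝔼 z, φ z) / 9 < |𝔼 z, φ z * bitSign (z j)|) :
    𝔼 z, φ z ≤ Real.exp (-(J.card : ℝ) / 162) := by
  set a := 𝔼 z, φ z with ha
  set c : ι → ℝ := fun j => 𝔼 z, φ z * bitSign (z j) with hc
  set s : ι → ℝ := fun j => if j ∈ J then (if 0 ≤ c j then 1 / 9 else -1 / 9) else 0 with hs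
  have hs2 : ∑ j, s j ^ 2 = J.card / 81 := by
    have : ∀ j, s j ^ 2 = if j ∈ J then (1 / 81 : ℝ) else 0 := by
      intro j
      simp only [hs]
      split_ifs <;> norm_num
    simp_rw [this]
    rw [Finset.sum_ite_mem]
    simp
    ring
  have hsc : J.card * (a / 81) ≤ ∑ j, s j * c j := by
    have : ∀ j, (if j ∈ J then a / 81 else 0) ≤ s j * c j := by
      intro j
      simp only [hs]
      by_cases hj : j ∈ J
      · have := hJ j hj
        change a / 9 < |c j| at this
        simp only [hj, if_true]
        split_ifs with h
        · rw [abs_of_nonneg h] at this; linarith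
        · rw [abs_of_neg (not_le.mp h)] at this; linarith
      · simp [hj]
    calc J.card * (a / 81) = ∑ j, (if j ∈ J then a / 81 else 0) := by
          rw [Finset.sum_ite_mem]; simp
      _ ≤ _ := Finset.sum_le_sum fun j _ => this j
  set Φ : (ι → Bool) → ℝ := fun z => ∑ j, s j * bitSign (z j) with hΦ
  have hφΦ : 𝔼 z, φ z * Φ z = ∑ j, s j * c j := by
    simp only [hΦ, hc, Finset.mul_sum, Finset.mul_expect]
    rw [Finset.expect_sum_comm]
    refine Finset.sum_congr rfl fun j _ => Finset.expect_congr rfl fun z _ => by ring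
  set q : ℝ := (J.card : ℝ) / 81 with hq
  have hpt : ∀ z, φ z + φ z * Φ z - q * φ z ≤ Real.exp (-q) * Real.exp (Φ z) := by
    intro z
    have e1 : Φ z - q + 1 ≤ Real.exp (Φ z - q) := Real.add_one_le_exp _
    have e2 : φ z * (Φ z - q + 1) ≤ φ z * Real.exp (Φ z - q) :=
      mul_le_mul_of_nonneg_left e1 (h0 z)
    have e3 : φ z * Real.exp (Φ z - q) ≤ 1 * Real.exp (Φ z - q) :=
      mul_le_mul_of_nonneg_right (h1 z) (Real.exp_pos _).le
    have e4 : Real.exp (-q) * Real.exp (Φ z) = Real.exp (Φ z - q) := by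
      rw [← Real.exp_add]; congr 1; ring
    rw [e4]
    linarith
  have hsum : a + ∑ j, s j * c j - q * a ≤ Real.exp (-q) * 𝔼 z, Real.exp (Φ z) := by
    rw [← hφΦ, ha, Finset.mul_expect, Finset.mul_expect, ← Finset.expect_add_distrib,
      ← Finset.expect_sub_distrib]
    exact Finset.expect_le_expect fun z _ => hpt z
  have hm := expect_exp_bitSign_le s
  rw [hs2] at hm
  have hfin : a ≤ Real.exp (-q) * Real.exp (J.card / 81 / 2) := by
    have : Real.exp (-q) * 𝔼 z, Real.exp (Φ z) ≤ Real.exp (-q) * Real.exp (J.card / 81 / 2) :=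
      mul_le_mul_of_nonneg_left hm (Real.exp_pos _).le
    have hqa : q * a = J.card * (a / 81) := by rw [hq]; ring
    linarith
  rw [← Real.exp_add] at hfin
  refine hfin.trans (le_of_eq ?_)
  congr 1
  rw [hq]
  ring

/-- The average of `X` over the subcube of the points that vanish off `D`. -/
noncomputable def maskAvg (X : (ι → Bool) → ℝ) (D : ι → Bool) : ℝ := 𝔼 z, X (mask D z)

/-- The average of `X` over the points that vanish off `D` except at `j`, where they are `v`. -/
noncomputable def maskAvgAt (X : (ι → Bool) → ℝ) (D : ι → Bool) (j : ι) (v : Bool) : ℝ :=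
  𝔼 z, X (Function.update (mask D z) j v)

/-- The coordinates in `D` with which `X` is noticeably correlated on the subcube of `D`. -/
noncomputable def biased (X : (ι → Bool) → ℝ) (D : ι → Bool) : Finset ι :=
  open Classical in
  Finset.univ.filter fun j => D j = true ∧
    maskAvg X D / 9 < |𝔼 z, X (mask D z) * bitSign (z j)|

theorem maskAvgAt_update (X : (ι → Bool) → ℝ) (D : ι → Bool) (j : ι) (v w : Bool) :
    maskAvgAt X (Function.update D j w) j v = maskAvgAt X D j v := by
  refine Finset.expect_congr rfl fun z _ => congrArg X ?_
  ext i
  by_cases h : i = j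
  · subst h; simp
  · simp [mask, h]

theorem maskAvg_of_true (X : (ι → Bool) → ℝ) (D : ι → Bool) (j : ι) (hD : D j = true) :
    maskAvg X D = (maskAvgAt X D j true + maskAvgAt X D j false) / 2 := by
  rw [maskAvg, expect_cube_split _ j]
  simp_rw [mask_update D _ j _ hD]
  rfl

theorem maskAvg_of_false (X : (ι → Bool) → ℝ) (D : ι → Bool) (j : ι) (hD : D j = false) :
    maskAvg X D = maskAvgAt X D j false := by
  refine Finset.expect_congr rfl fun z _ => congrArg X ?_
  rw [eq_comm, Function.update_eq_self_iff]
  simp [mask, hD]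

theorem expect_mask_mul_bitSign (X : (ι → Bool) → ℝ) (D : ι → Bool) (j : ι) (hD : D j = true) :
    𝔼 z, X (mask D z) * bitSign (z j) =
      (maskAvgAt X D j true - maskAvgAt X D j false) / 2 := by
  rw [expect_cube_split _ j]
  simp_rw [mask_update D _ j _ hD]
  simp [bitSign, maskAvgAt, Finset.expect_neg_distrib, sub_eq_add_neg]

theorem mem_biased_iff (X : (ι → Bool) → ℝ) (D : ι → Bool) (j : ι) (hD : D j = true) :
    j ∈ biased X D ↔ (maskAvgAt X D j true + maskAvgAt X D j false) / 9 <
      |maskAvgAt X D j true - maskAvgAt X D j false| := by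
  simp only [biased, Finset.mem_filter, Finset.mem_univ, true_and, hD,
    expect_mask_mul_bitSign X D j hD, maskAvg_of_true X D j hD, abs_div, abs_two]
  constructor <;> intro h <;> linarith

theorem notMem_biased_of_false (X : (ι → Bool) → ℝ) (D : ι → Bool) (j : ι) (hD : D j = false) :
    j ∉ biased X D := by
  simp [biased, hD]

theorem maskAvg_nonneg {X : (ι → Bool) → ℝ} (h0 : ∀ x, 0 ≤ X x) (D : ι → Bool) :
    0 ≤ maskAvg X D :=
  Finset.expect_nonneg fun _ _ => h0 _

theorem maskAvg_le_one {X : (ι → Bool) → ℝ} (h1 : ∀ x, X x ≤ 1) (D : ι → Bool) :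
    maskAvg X D ≤ 1 :=
  Finset.expect_le Finset.univ_nonempty fun _ _ => h1 _

theorem maskAvgAt_nonneg {X : (ι → Bool) → ℝ} (h0 : ∀ x, 0 ≤ X x) (D : ι → Bool) (j : ι)
    (v : Bool) : 0 ≤ maskAvgAt X D j v :=
  Finset.expect_nonneg fun _ _ => h0 _

theorem maskAvg_le_exp {X : (ι → Bool) → ℝ} (h0 : ∀ x, 0 ≤ X x) (h1 : ∀ x, X x ≤ 1)
    (D : ι → Bool) : maskAvg X D ≤ Real.exp (-((biased X D).card : ℝ) / 162) :=
  expect_le_exp_of_biased _ (fun _ => h0 _) (fun _ => h1 _) _ fun j hj => by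
    classical
    exact ((Finset.mem_filter.mp hj).2).2

theorem maskAvg_mul_card_biased_le {X : (ι → Bool) → ℝ} (h0 : ∀ x, 0 ≤ X x)
    (h1 : ∀ x, X x ≤ 1) (D : ι → Bool) :
    maskAvg X D * (biased X D).card ≤
      Fintype.card ι / 100 * maskAvg X D +
        Fintype.card ι * Real.exp (-(Fintype.card ι : ℝ) / 16200) := by
  have ha := maskAvg_nonneg h0 D
  have hcard : ((biased X D).card : ℝ) ≤ Fintype.card ι := by
    exact_mod_cast Finset.card_le_univ _
  have hN : (0 : ℝ) ≤ Fintype.card ι := Nat.cast_nonneg _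
  have he := (Real.exp_pos (-(Fintype.card ι : ℝ) / 16200)).le
  by_cases h : ((biased X D).card : ℝ) ≤ Fintype.card ι / 100
  · have := mul_le_mul_of_nonneg_left h ha
    have := mul_nonneg hN he
    linarith
  · have hb := maskAvg_le_exp h0 h1 D
    have : Real.exp (-((biased X D).card : ℝ) / 162) ≤
        Real.exp (-(Fintype.card ι : ℝ) / 16200) := by
      apply Real.exp_le_exp.mpr
      linarith
    have h2 := mul_le_mul (hb.trans this) hcard (Nat.cast_nonneg _) he
    have h3 : 0 ≤ Fintype.card ι / 100 * maskAvg X D := by positivity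
    linarith

/-- The inequality between the weights of the four settings of one coordinate in a rectangle. -/
theorem coordinate_weights_le {α₀ α₁ β₀ β₁ s t : ℝ} (hα₀ : 0 ≤ α₀) (hα₁ : 0 ≤ α₁)
    (hβ₀ : 0 ≤ β₀) (hβ₁ : 0 ≤ β₁) (hs : 0 ≤ s) (ht : 0 ≤ t)
    (hs' : (α₁ + α₀) / 9 < |α₁ - α₀| → s = 1) (ht' : (β₁ + β₀) / 9 < |β₁ - β₀| → t = 1) :
    (α₁ + α₀) / 2 * β₀ + α₀ * ((β₁ + β₀) / 2) ≤
      2 * (45 / 32) * (α₁ * β₁) +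
        4 * ((α₁ + α₀) / 2 * β₀ * s + α₀ * ((β₁ + β₀) / 2) * t) := by
  have p00 := mul_nonneg hα₀ hβ₀
  have p01 := mul_nonneg hα₀ hβ₁
  have p10 := mul_nonneg hα₁ hβ₀
  have p11 := mul_nonneg hα₁ hβ₁
  have e1 : (α₁ + α₀) / 2 * β₀ = α₁ * β₀ / 2 + α₀ * β₀ / 2 := by ring
  have e2 : α₀ * ((β₁ + β₀) / 2) = α₀ * β₁ / 2 + α₀ * β₀ / 2 := by ring
  rw [e1, e2]
  have q1 : 0 ≤ (α₁ * β₀ / 2 + α₀ * β₀ / 2) * s := by positivity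
  have q2 : 0 ≤ (α₀ * β₁ / 2 + α₀ * β₀ / 2) * t := by positivity
  by_cases hx : (α₁ + α₀) / 9 < |α₁ - α₀|
  · rw [hs' hx] at *
    by_cases hy : (β₁ + β₀) / 9 < |β₁ - β₀|
    · rw [ht' hy] at *
      linarith
    · have := abs_le.mp (not_lt.mp hy)
      have hb : β₁ ≤ 5 / 4 * β₀ := by linarith
      have := mul_le_mul_of_nonneg_left hb hα₀
      linarith
  · have := abs_le.mp (not_lt.mp hx)
    have ha : α₁ ≤ 5 / 4 * α₀ := by linarith
    have ha' : α₀ ≤ 5 / 4 * α₁ := by linarith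
    by_cases hy : (β₁ + β₀) / 9 < |β₁ - β₀|
    · rw [ht' hy] at *
      have := mul_le_mul_of_nonneg_right ha hβ₀
      linarith
    · have := abs_le.mp (not_lt.mp hy)
      have hb' : β₀ ≤ 5 / 4 * β₁ := by linarith
      have r1 := mul_le_mul_of_nonneg_left hb' hα₁
      have r2 := mul_le_mul_of_nonneg_right ha' hβ₁
      have r3 := mul_le_mul_of_nonneg_left hb' hα₀
      linarith

theorem expect_maskAvg_mul_le_coordinate {X Y : (ι → Bool) → ℝ} (hX : ∀ x, 0 ≤ X x)
    (hY : ∀ y, 0 ≤ Y y) (j : ι) :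
    𝔼 D, maskAvg X D * maskAvg Y (compl D) ≤
      45 / 32 * 𝔼 D, maskAvgAt X D j true * maskAvgAt Y (compl D) j true +
        4 * 𝔼 D, maskAvg X D * maskAvg Y (compl D) *
          ((if j ∈ biased X D then 1 else 0) + (if j ∈ biased Y (compl D) then 1 else 0)) := by
  rw [Finset.mul_expect, Finset.mul_expect, ← Finset.expect_add_distrib,
    expect_cube_split _ j, expect_cube_split (fun D => _ + _) j]
  refine div_le_div_of_nonneg_right ?_ zero_le_two
  rw [← Finset.expect_add_distrib, ← Finset.expect_add_distrib]
  refine Finset.expect_le_expect fun D _ => ?_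
  have t1 : Function.update D j true j = true := by simp
  have t2 : Function.update D j false j = false := by simp
  have c1 : Function.update (compl D) j true j = true := by simp
  have c2 : Function.update (compl D) j false j = false := by simp
  simp only [compl_update, Bool.not_true, Bool.not_false, maskAvgAt_update,
    maskAvg_of_true _ _ _ t1, maskAvg_of_true _ _ _ c1, maskAvg_of_false _ _ _ t2,
    maskAvg_of_false _ _ _ c2, notMem_biased_of_false _ _ _ t2, notMem_biased_of_false _ _ _ c2,
    if_false, add_zero, zero_add]
  have key := coordinate_weights_le (α₀ := maskAvgAt X D j false) (α₁ := maskAvgAt X D j true)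
    (β₀ := maskAvgAt Y (compl D) j false) (β₁ := maskAvgAt Y (compl D) j true)
    (s := if j ∈ biased X (Function.update D j true) then 1 else 0)
    (t := if j ∈ biased Y (Function.update (compl D) j true) then 1 else 0)
    (maskAvgAt_nonneg hX _ _ _) (maskAvgAt_nonneg hX _ _ _) (maskAvgAt_nonneg hY _ _ _)
    (maskAvgAt_nonneg hY _ _ _) (by positivity) (by positivity)
    (fun h => if_pos ((mem_biased_iff _ _ _ t1).mpr (by simpa only [maskAvgAt_update] using h)))
    (fun h => if_pos ((mem_biased_iff _ _ _ c1).mpr (by simpa only [maskAvgAt_update] using h)))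
  refine key.trans (le_of_eq ?_)
  ring

/-- Corruption bound for set disjointness: a rectangle that has noticeable weight on the disjoint
pairs has comparable weight on the uniquely intersecting ones. -/
theorem corruption_bound [Nonempty ι] {X Y : (ι → Bool) → ℝ} (hX : ∀ x, 0 ≤ X x)
    (hX' : ∀ x, X x ≤ 1) (hY : ∀ y, 0 ≤ Y y) (hY' : ∀ y, Y y ≤ 1) :
    23 / 25 * 𝔼 D, maskAvg X D * maskAvg Y (compl D) ≤
      45 / 32 * 𝔼 j, 𝔼 D, maskAvgAt X D j true * maskAvgAt Y (compl D) j true +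
        8 * Real.exp (-(Fintype.card ι : ℝ) / 16200) := by
  set N : ℝ := (Fintype.card ι : ℝ) with hN
  have hNpos : 0 < N := by rw [hN]; exact_mod_cast Fintype.card_pos
  set M := 𝔼 D, maskAvg X D * maskAvg Y (compl D) with hM
  set E := Real.exp (-N / 16200) with hE
  have hsum : N * M ≤ 45 / 32 * ∑ j, 𝔼 D, maskAvgAt X D j true * maskAvgAt Y (compl D) j true +
      4 * ∑ j, 𝔼 D, maskAvg X D * maskAvg Y (compl D) *
          ((if j ∈ biased X D then 1 else 0) + (if j ∈ biased Y (compl D) then 1 else 0)) := by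
    rw [Finset.mul_sum, Finset.mul_sum, ← Finset.sum_add_distrib]
    calc N * M = ∑ _j : ι, M := by simp [hN]
      _ ≤ _ := Finset.sum_le_sum fun j _ => expect_maskAvg_mul_le_coordinate hX hY j
  have hbad : ∑ j, 𝔼 D, maskAvg X D * maskAvg Y (compl D) *
      ((if j ∈ biased X D then 1 else 0) + (if j ∈ biased Y (compl D) then (1 : ℝ) else 0)) ≤
      N / 50 * M + 2 * (N * E) := by
    rw [← Finset.expect_sum_comm]
    have hconst : 2 * (N * E) = 𝔼 _D : ι → Bool, 2 * (N * E) := by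
      rw [Fintype.expect_const]
    rw [hM, hconst, Finset.mul_expect, ← Finset.expect_add_distrib]
    refine Finset.expect_le_expect fun D _ => ?_
    rw [← Finset.mul_sum, Finset.sum_add_distrib]
    simp only [Finset.sum_boole, Finset.filter_univ_mem]
    have a0 := maskAvg_nonneg hX D
    have b0 := maskAvg_nonneg hY (compl D)
    have a1 := maskAvg_le_one hX' D
    have b1 := maskAvg_le_one hY' (compl D)
    have k1 := mul_le_mul_of_nonneg_left (maskAvg_mul_card_biased_le hX hX' D) b0
    have k2 := mul_le_mul_of_nonneg_left (maskAvg_mul_card_biased_le hY hY' (compl D)) a0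
    rw [← hN, ← hE] at k1 k2
    have hNE : 0 ≤ N * E := mul_nonneg hNpos.le (Real.exp_pos _).le
    have l1 := mul_le_mul_of_nonneg_right b1 hNE
    have l2 := mul_le_mul_of_nonneg_right a1 hNE
    linarith
  have hexp : N * 𝔼 j, 𝔼 D, maskAvgAt X D j true * maskAvgAt Y (compl D) j true =
      ∑ j, 𝔼 D, maskAvgAt X D j true * maskAvgAt Y (compl D) j true := by
    rw [Fintype.expect_eq_sum_div_card, ← hN]
    field_simp
  rw [← hexp] at hsum
  refine le_of_mul_le_mul_left ?_ hNpos
  linarith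

end Corruption
end Streaming

namespace Streaming
section RectanglePartition

open MeasureTheory

theorem integrable_expect {Ω κ : Type*} [MeasurableSpace Ω] {P : Measure Ω} [Fintype κ]
    {f : κ → Ω → ℝ} (hf : ∀ i, Integrable (f i) P) : Integrable (fun ω => 𝔼 i, f i ω) P := by
  simp_rw [Fintype.expect_eq_sum_div_card]
  exact (integrable_finsetSum _ fun i _ => hf i).div_const _

theorem integral_expect {Ω κ : Type*} [MeasurableSpace Ω] {P : Measure Ω} [Fintype κ]
    {f : κ → Ω → ℝ} (hf : ∀ i, Integrable (f i) P) :
    ∫ ω, 𝔼 i, f i ω ∂P = 𝔼 i, ∫ ω, f i ω ∂P := by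
  simp_rw [Fintype.expect_eq_sum_div_card]
  rw [integral_div, integral_finsetSum _ fun i _ => hf i]

/-- If events that hold likely on disjoint pairs and unlikely on uniquely intersecting pairs are,
for every outcome, disjoint unions of rectangles, then there are exponentially many rectangles. -/
theorem exp_le_card_of_rectangle_partition {Ω ι τ : Type*} [MeasurableSpace Ω] (P : Measure Ω)
    [IsProbabilityMeasure P] [Fintype ι] [DecidableEq ι] [Nonempty ι] [Fintype τ]
    (X Y : Ω → τ → (ι → Bool) → ℝ)
    (hX : ∀ ω t x, 0 ≤ X ω t x) (hX' : ∀ ω t x, X ω t x ≤ 1)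
    (hY : ∀ ω t y, 0 ≤ Y ω t y) (hY' : ∀ ω t y, Y ω t y ≤ 1)
    (E : (ι → Bool) → (ι → Bool) → Set Ω) (hE : ∀ x y, MeasurableSet (E x y))
    (hpart : ∀ ω x y, (E x y).indicator 1 ω = ∑ t, X ω t x * Y ω t y)
    (hdisj : ∀ x y, (∀ i, ¬(x i = true ∧ y i = true)) → 2 / 3 ≤ P.real (E x y))
    (hint : ∀ x y j, (∀ i, (x i = true ∧ y i = true) ↔ i = j) → P.real (E x y) ≤ 1 / 3) :
    Real.exp ((Fintype.card ι : ℝ) / 16200) ≤ 60 * Fintype.card τ := by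
  set f : (ι → Bool) → (ι → Bool) → Ω → ℝ := fun x y => (E x y).indicator 1 with hf
  have hfi : ∀ x y, Integrable (f x y) P := fun x y =>
    (integrable_const (1 : ℝ)).indicator (hE x y)
  have hfint : ∀ x y, ∫ ω, f x y ω ∂P = P.real (E x y) := fun x y => integral_indicator_one (hE x y)
  set r := Real.exp (-(Fintype.card ι : ℝ) / 16200) with hr
  have hpt : ∀ ω, 23 / 25 * 𝔼 D : ι → Bool, 𝔼 z, 𝔼 z', f (mask D z) (mask (compl D) z') ω ≤
      45 / 32 * (𝔼 j, 𝔼 D : ι → Bool, 𝔼 z, 𝔼 z', f (Function.update (mask D z) j true)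
        (Function.update (mask (compl D) z') j true) ω) + Fintype.card τ * (8 * r) := by
    intro ω
    have h := Finset.sum_le_sum fun t (_ : t ∈ (Finset.univ : Finset τ)) =>
      corruption_bound (hX ω t) (hX' ω t) (hY ω t) (hY' ω t)
    rw [Finset.sum_add_distrib, ← Finset.mul_sum, ← Finset.mul_sum, Finset.sum_const,
      Finset.card_univ, nsmul_eq_mul] at h
    simp only [← Finset.expect_sum_comm, maskAvg, maskAvgAt, Finset.expect_mul_expect,
      ← hpart] at h
    exact h
  have hint_lhs : ∫ ω, 𝔼 D : ι → Bool, 𝔼 z, 𝔼 z', f (mask D z) (mask (compl D) z') ω ∂P =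
      𝔼 D : ι → Bool, 𝔼 z, 𝔼 z', P.real (E (mask D z) (mask (compl D) z')) := by
    rw [integral_expect fun D => integrable_expect fun z => integrable_expect fun z' => hfi _ _]
    refine Finset.expect_congr rfl fun D _ => ?_
    rw [integral_expect fun z => integrable_expect fun z' => hfi _ _]
    refine Finset.expect_congr rfl fun z _ => ?_
    rw [integral_expect fun z' => hfi _ _]
    simp_rw [hfint]
  have hint_rhs : ∫ ω, (𝔼 j, 𝔼 D : ι → Bool, 𝔼 z, 𝔼 z', f (Function.update (mask D z) j true)
        (Function.update (mask (compl D) z') j true) ω) ∂P =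
      𝔼 j, 𝔼 D : ι → Bool, 𝔼 z, 𝔼 z', P.real (E (Function.update (mask D z) j true)
        (Function.update (mask (compl D) z') j true)) := by
    rw [integral_expect fun j => integrable_expect fun D => integrable_expect fun z =>
      integrable_expect fun z' => hfi _ _]
    refine Finset.expect_congr rfl fun j _ => ?_
    rw [integral_expect fun D => integrable_expect fun z => integrable_expect fun z' => hfi _ _]
    refine Finset.expect_congr rfl fun D _ => ?_
    rw [integral_expect fun z => integrable_expect fun z' => hfi _ _]
    refine Finset.expect_congr rfl fun z _ => ?_
    rw [integral_expect fun z' => hfi _ _]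
    simp_rw [hfint]
  have hI1 : Integrable (fun ω => 𝔼 D : ι → Bool, 𝔼 z, 𝔼 z',
      f (mask D z) (mask (compl D) z') ω) P :=
    integrable_expect fun D => integrable_expect fun z => integrable_expect fun z' => hfi _ _
  have hI2 : Integrable (fun ω => 𝔼 j, 𝔼 D : ι → Bool, 𝔼 z, 𝔼 z',
      f (Function.update (mask D z) j true) (Function.update (mask (compl D) z') j true) ω) P :=
    integrable_expect fun j => integrable_expect fun D => integrable_expect fun z =>
      integrable_expect fun z' => hfi _ _
  have hmono := integral_mono (hI1.const_mul _)
    ((hI2.const_mul (45 / 32)).add (integrable_const (Fintype.card τ * (8 * r)))) hpt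
  simp only [Pi.add_apply] at hmono
  rw [integral_add (hI2.const_mul _) (integrable_const _), integral_const_mul,
    integral_const_mul, hint_lhs, hint_rhs] at hmono
  simp only [integral_const, probReal_univ, one_smul] at hmono
  have hL : 2 / 3 ≤ 𝔼 D : ι → Bool, 𝔼 z, 𝔼 z', P.real (E (mask D z) (mask (compl D) z')) := by
    refine Finset.le_expect Finset.univ_nonempty fun D _ => ?_
    refine Finset.le_expect Finset.univ_nonempty fun z _ => ?_
    refine Finset.le_expect Finset.univ_nonempty fun z' _ => hdisj _ _ fun i => ?_
    cases h : D i <;> simp [mask, compl, h]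
  have hR : 𝔼 j, 𝔼 D : ι → Bool, 𝔼 z, 𝔼 z', P.real (E (Function.update (mask D z) j true)
        (Function.update (mask (compl D) z') j true)) ≤ 1 / 3 := by
    refine Finset.expect_le Finset.univ_nonempty fun j _ => ?_
    refine Finset.expect_le Finset.univ_nonempty fun D _ => ?_
    refine Finset.expect_le Finset.univ_nonempty fun z _ => ?_
    refine Finset.expect_le Finset.univ_nonempty fun z' _ => hint _ _ j fun i => ?_
    by_cases hij : i = j
    · subst hij; simp
    · cases h : D i <;> simp [mask, compl, h, hij]
  have hfin : 1 ≤ 60 * (Fintype.card τ * r) := by linarith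
  have hr' : r = (Real.exp ((Fintype.card ι : ℝ) / 16200))⁻¹ := by
    rw [hr, ← Real.exp_neg]; congr 1; ring
  rw [hr', ← mul_assoc, ← div_eq_mul_inv, le_div_iff₀ (Real.exp_pos _), one_mul] at hfin
  exact hfin

end RectanglePartition
end Streaming

namespace Streaming
namespace Algorithm

variable {Ω : Type*} [MeasurableSpace Ω] {n : ℕ}

theorem read_append (A : Algorithm Ω n) (ω : Ω) (p i : ℕ) (s : List Bool) (l₁ l₂ : List (Fin n)) :
    A.read ω p i s (l₁ ++ l₂) = A.read ω p (i + l₁.length) (A.read ω p i s l₁) l₂ := by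
  induction l₁ generalizing i s with
  | nil => simp [read]
  | cons d l ih =>
    simp only [List.cons_append, read, List.length_cons]
    rw [ih, Nat.add_right_comm, Nat.add_assoc]

theorem measurableSet_read (A : Algorithm Ω n) (p i : ℕ) (s : Ω → List Bool)
    (hs : ∀ t, MeasurableSet {ω | s ω = t}) (l : List (Fin n)) (t : List Bool) :
    MeasurableSet {ω | A.read ω p i (s ω) l = t} := by
  induction l generalizing i s with
  | nil => exact hs t
  | cons d l ih =>
    refine ih (i + 1) (fun ω => A.step ω p i (s ω) d) fun u => ?_
    have : {ω | A.step ω p i (s ω) d = u} = ⋃ v, {ω | s ω = v} ∩ {ω | A.step ω p i v d = u} := by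
      ext ω; simp
    rw [this]
    exact .iUnion fun v => (hs v).inter (A.measurable_step _ _ _ _ _)

theorem measurableSet_afterPasses (A : Algorithm Ω n) (S : List (Fin n)) (p : ℕ)
    (t : List Bool) : MeasurableSet {ω | A.afterPasses ω S p = t} := by
  induction p generalizing t with
  | zero => exact A.measurable_init t
  | succ p ih =>
    have : {ω | A.afterPasses ω S (p + 1) = t} =
        ⋃ v, {ω | A.read ω p 0 (A.afterPasses ω S p) S = v} ∩ {ω | A.endPass ω p v = t} := by
      ext ω; simp [afterPasses]
    rw [this]
    exact .iUnion fun v => (A.measurableSet_read p 0 _ ih S v).inter (A.measurable_endPass _ _ _)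

theorem measurable_output (A : Algorithm Ω n) (k : ℕ) (S : List (Fin n)) :
    Measurable fun ω => A.output k ω S := by
  intro T hT
  have : (fun ω => A.output k ω S) ⁻¹' T =
      ⋃ v, {ω | A.afterPasses ω S k = v} ∩ (fun ω => A.out ω v) ⁻¹' T := by
    ext ω; simp [output]
  rw [this]
  exact .iUnion fun v => (A.measurableSet_afterPasses S k v).inter (A.measurable_out v hT)

end Algorithm

/-- The bit strings of length at most `b`. -/
abbrev Word (b : ℕ) : Type := {l : List Bool // l.length ≤ b}

/-- A word, padded to a fixed length. -/
def Word.letters {b : ℕ} (w : Word b) : Fin b → Option Bool := fun i => w.1[(i : ℕ)]?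

theorem Word.letters_injective (b : ℕ) : Function.Injective (Word.letters (b := b)) := by
  rintro ⟨l, hl⟩ ⟨l', hl'⟩ h
  refine Subtype.ext (List.ext_getElem? fun i => ?_)
  by_cases hi : i < b
  · exact congrFun h ⟨i, hi⟩
  · rw [List.getElem?_eq_none (by simp only; omega), List.getElem?_eq_none (by simp only; omega)]

noncomputable instance (b : ℕ) : Fintype (Word b) :=
  Fintype.ofInjective _ (Word.letters_injective b)

theorem card_word_le (b : ℕ) : Fintype.card (Word b) ≤ 3 ^ b := by
  simpa using Fintype.card_le_of_injective _ (Word.letters_injective b)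

/-- The records of a two-party simulation of `k` passes: the memories in the middle of the passes,
and the memories between the passes. -/
abbrev Transcript (k b : ℕ) : Type := (Fin k → Word b) × (Fin (k + 1) → Word b)

theorem card_transcript_le (k b : ℕ) :
    (Fintype.card (Transcript k b) : ℝ) ≤ 3 ^ (b * (2 * k + 1)) := by
  have : Fintype.card (Transcript k b) = Fintype.card (Word b) ^ (2 * k + 1) := by
    simp only [Fintype.card_prod, Fintype.card_pi, Finset.prod_const, Finset.card_univ,
      Fintype.card_fin]
    ring
  rw [this, pow_mul]
  exact_mod_cast Nat.pow_le_pow_left (card_word_le b) _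

section Simulation

variable {Ω : Type*} [MeasurableSpace Ω] {n k b : ℕ}

/-- The first party's input `S` is consistent with the transcript. -/
def FirstConsistent (A : Algorithm Ω n) (ω : Ω) (t : Transcript k b) (S : List (Fin n)) : Prop :=
  A.init ω = (t.2 0).1 ∧ ∀ p : Fin k, A.read ω p 0 (t.2 p.castSucc).1 S = (t.1 p).1

/-- The second party's input `S`, read after `L` tokens, is consistent with the transcript. -/
def SecondConsistent (A : Algorithm Ω n) (ω : Ω) (L : ℕ) (t : Transcript k b)
    (S : List (Fin n)) : Prop :=
  ∀ p : Fin k, A.endPass ω p (A.read ω p L (t.1 p).1 S) = (t.2 p.succ).1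

theorem afterPasses_eq_of_consistent (A : Algorithm Ω n) (ω : Ω) (t : Transcript k b)
    (S S' : List (Fin n)) (h : FirstConsistent A ω t S)
    (h' : SecondConsistent A ω S.length t S') (p : ℕ) (hp : p < k + 1) :
    A.afterPasses ω (S ++ S') p = (t.2 ⟨p, hp⟩).1 := by
  induction p with
  | zero => exact h.1
  | succ p ih =>
    have hpk : p < k := by omega
    rw [Algorithm.afterPasses, ih (by omega), Algorithm.read_append]
    have h1 := h.2 ⟨p, hpk⟩
    have h2 := h' ⟨p, hpk⟩
    simp only [Fin.castSucc_mk, Fin.succ_mk] at h1 h2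
    rw [h1, Nat.zero_add, h2]

theorem exists_transcript (A : Algorithm Ω n) (ω : Ω) (m : ℕ) (hA : A.UsesAtMost k m b)
    (S S' : List (Fin n)) (hS : S ++ S' ∈ insertionStreams n m) :
    ∃ t : Transcript k b, FirstConsistent A ω t S ∧ SecondConsistent A ω S.length t S' := by
  obtain ⟨h1, h2⟩ := hA _ hS ω
  have hend : ∀ p < k + 1, (A.afterPasses ω (S ++ S') p).length ≤ b := by
    intro p hp
    rcases Nat.lt_or_ge p k with h | h
    · simpa [Algorithm.read] using h1 p h 0 (Nat.zero_le _)
    · obtain rfl : p = k := by omega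
      exact h2
  have hmid : ∀ p < k, (A.read ω p 0 (A.afterPasses ω (S ++ S') p) S).length ≤ b := by
    intro p hp
    simpa using h1 p hp S.length (by simp)
  refine ⟨(fun p => ⟨_, hmid p p.2⟩, fun p => ⟨_, hend p p.2⟩), ⟨rfl, fun p => rfl⟩, fun p => ?_⟩
  change A.endPass ω p (A.read ω p _ (A.read ω p 0 _ S) S') = A.afterPasses ω (S ++ S') (p + 1)
  rw [Algorithm.afterPasses, Algorithm.read_append, Nat.zero_add]

theorem transcript_unique (A : Algorithm Ω n) (ω : Ω) (t t' : Transcript k b)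
    (S S' : List (Fin n)) (h : FirstConsistent A ω t S) (h' : SecondConsistent A ω S.length t S')
    (g : FirstConsistent A ω t' S) (g' : SecondConsistent A ω S.length t' S') : t = t' := by
  have h2 : t.2 = t'.2 := by
    funext p
    refine Subtype.ext ?_
    rw [← afterPasses_eq_of_consistent A ω t S S' h h' p p.2,
      ← afterPasses_eq_of_consistent A ω t' S S' g g' p p.2]
  refine Prod.ext ?_ h2
  funext p
  refine Subtype.ext ?_
  rw [← h.2 p, ← g.2 p, h2]

open Classical in
/-- The outcomes for which the output is acceptable decompose into rectangles, one for each
transcript. -/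
theorem indicator_output_eq_sum (A : Algorithm Ω n) (ω : Ω) (m : ℕ) (hA : A.UsesAtMost k m b)
    (S S' : List (Fin n)) (hS : S ++ S' ∈ insertionStreams n m) (T : Set ℝ) :
    {ω | A.output k ω (S ++ S') ∈ T}.indicator (1 : Ω → ℝ) ω =
      ∑ t : Transcript k b, (if FirstConsistent A ω t S then 1 else 0) *
        (if SecondConsistent A ω S.length t S' ∧ A.out ω (t.2 (Fin.last k)).1 ∈ T
          then 1 else 0) := by
  obtain ⟨t, h, h'⟩ := exists_transcript A ω m hA S S' hS
  rw [Finset.sum_eq_single t]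
  · have : A.output k ω (S ++ S') = A.out ω (t.2 (Fin.last k)).1 := by
      rw [Algorithm.output, afterPasses_eq_of_consistent A ω t S S' h h' k (Nat.lt_succ_self k)]
      rfl
    simp [Set.indicator_apply, h, h', this]
  · intro t' _ hne
    by_cases g : FirstConsistent A ω t' S
    · have g' : ¬ SecondConsistent A ω S.length t' S' := fun g' =>
        hne (transcript_unique A ω t' t S S' g g' h h')
      simp [g']
    · simp [g]
  · simp

end Simulation
end Streaming

namespace Streaming
section Blocks

variable {n N : ℕ}

/-- The first half of the stream: `F j` copies of the item that `x` selects in block `j`. -/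
def firstStream (e : Fin N × Bool ↪ Fin n) (F : Fin N → ℕ) (x : Fin N → Bool) : List (Fin n) :=
  (List.finRange N).flatMap fun j => List.replicate (F j) (e (j, x j))

/-- The second half of the stream: `c j (y j) w` copies of item `w` of block `j`. -/
def secondStream (e : Fin N × Bool ↪ Fin n) (c : Fin N → Bool → Bool → ℕ) (y : Fin N → Bool) :
    List (Fin n) :=
  (List.finRange N).flatMap fun j =>
    List.replicate (c j (y j) false) (e (j, false)) ++
      List.replicate (c j (y j) true) (e (j, true))

/-- The frequency of item `w` of block `j` if the bits of the two inputs there are `u`, `v`. -/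
def blockFreq (F : Fin N → ℕ) (c : Fin N → Bool → Bool → ℕ) (j : Fin N) (u v w : Bool) : ℕ :=
  (if u = w then F j else 0) + c j v w

/-- The contribution of block `j` to `g(f)` if the bits of the two inputs there are `u`, `v`. -/
def blockValue (g : ℕ → ℝ) (F : Fin N → ℕ) (c : Fin N → Bool → Bool → ℕ) (j : Fin N)
    (u v : Bool) : ℝ :=
  ∑ w, g (blockFreq F c j u v w)

theorem length_firstStream (e : Fin N × Bool ↪ Fin n) (F : Fin N → ℕ) (x : Fin N → Bool) :
    (firstStream e F x).length = ∑ j, F j := by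
  simp [firstStream, List.length_flatMap, Fin.sum_univ_def]

theorem count_firstStream (e : Fin N × Bool ↪ Fin n) (F : Fin N → ℕ) (x : Fin N → Bool)
    (j : Fin N) (w : Bool) :
    (firstStream e F x).count (e (j, w)) = if x j = w then F j else 0 := by
  rw [firstStream, List.count_flatMap, ← Fin.sum_univ_def, Finset.sum_eq_single j]
  · simp [List.count_replicate]
  · intro i _ hi
    simp [List.count_replicate, hi]
  · simp

theorem count_secondStream (e : Fin N × Bool ↪ Fin n) (c : Fin N → Bool → Bool → ℕ)
    (y : Fin N → Bool) (j : Fin N) (w : Bool) :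
    (secondStream e c y).count (e (j, w)) = c j (y j) w := by
  rw [secondStream, List.count_flatMap, ← Fin.sum_univ_def, Finset.sum_eq_single j]
  · cases w <;> simp [List.count_replicate]
  · intro i _ hi
    simp [List.count_replicate, hi]
  · simp

theorem freq_blockStream (e : Fin N × Bool ↪ Fin n) (F : Fin N → ℕ)
    (c : Fin N → Bool → Bool → ℕ) (x y : Fin N → Bool) (j : Fin N) (w : Bool) :
    freq (firstStream e F x ++ secondStream e c y) (e (j, w)) =
      blockFreq F c j (x j) (y j) w := by
  simp only [freq, List.count_append, count_firstStream, count_secondStream, blockFreq]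

theorem freq_blockStream_of_notMem (e : Fin N × Bool ↪ Fin n) (F : Fin N → ℕ)
    (c : Fin N → Bool → Bool → ℕ) (x y : Fin N → Bool) (d : Fin n) (hd : d ∉ Set.range e) :
    freq (firstStream e F x ++ secondStream e c y) d = 0 := by
  rw [freq, List.count_eq_zero]
  intro h
  rcases List.mem_append.mp h with h | h
  · obtain ⟨j, -, hj⟩ := List.mem_flatMap.mp h
    exact hd ⟨_, (List.eq_of_mem_replicate hj).symm⟩
  · obtain ⟨j, -, hj⟩ := List.mem_flatMap.mp h
    rcases List.mem_append.mp hj with hj | hj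
    · exact hd ⟨_, (List.eq_of_mem_replicate hj).symm⟩
    · exact hd ⟨_, (List.eq_of_mem_replicate hj).symm⟩

theorem sum_freq_blockStream {M : Type*} [AddCommMonoid M] (φ : ℕ → M) (hφ : φ 0 = 0)
    (e : Fin N × Bool ↪ Fin n) (F : Fin N → ℕ) (c : Fin N → Bool → Bool → ℕ)
    (x y : Fin N → Bool) :
    ∑ d, φ (freq (firstStream e F x ++ secondStream e c y) d) =
      ∑ j, ∑ w, φ (blockFreq F c j (x j) (y j) w) := by
  rw [← Fintype.sum_prod_type', ← Finset.sum_subset (Finset.subset_univ (Finset.univ.map e)),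
    Finset.sum_map]
  · exact Finset.sum_congr rfl fun p _ => by rw [freq_blockStream]
  · intro d _ hd
    rw [freq_blockStream_of_notMem _ _ _ _ _ _ (by simpa using hd), hφ]

theorem sumOn_eq_sum {g : ℕ → ℝ} (hg : g 0 = 0) (f : Fin n → ℕ) : sumOn g f = ∑ d, g (f d) := by
  rw [sumOn, supp, Finset.sum_filter]
  refine Finset.sum_congr rfl fun d _ => ?_
  by_cases h : f d = 0 <;> simp [h, hg]

theorem sumOn_blockStream {g : ℕ → ℝ} (hg : g 0 = 0) (e : Fin N × Bool ↪ Fin n)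
    (F : Fin N → ℕ) (c : Fin N → Bool → Bool → ℕ) (x y : Fin N → Bool) :
    sumOn g (freq (firstStream e F x ++ secondStream e c y)) =
      ∑ j, blockValue g F c j (x j) (y j) := by
  rw [sumOn_eq_sum hg, sum_freq_blockStream g hg]
  rfl

/-- Space bound from an embedding of set disjointness into blocks of two items each. The values of
`g(f)` on disjoint inputs depend on the second input only, and a unique intersection changes them
noticeably. -/
theorem exp_le_of_blocks {Ω : Type*} [MeasurableSpace Ω] (P : MeasureTheory.Measure Ω)
    [MeasureTheory.IsProbabilityMeasure P] {m k b : ℕ} {g : ℕ → ℝ} {ε : ℝ} (hg : g 0 = 0)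
    (hN : 0 < N) (A : Algorithm Ω n) (hA : A.IsApprox P k m g ε) (hb : A.UsesAtMost k m b)
    (e : Fin N × Bool ↪ Fin n) (F : Fin N → ℕ) (c : Fin N → Bool → Bool → ℕ)
    (hm : ∀ x y : Fin N → Bool, ∑ j, ∑ w, blockFreq F c j (x j) (y j) w ≤ m)
    (hfirst : ∀ j, blockValue g F c j true false = blockValue g F c j false false)
    (hgap : ∀ (y : Fin N → Bool) (i : Fin N), y i = true →
      ∀ B : ℝ, B = ∑ j, blockValue g F c j false (y j) →
      ∀ B' : ℝ, B' = B + blockValue g F c i true true - blockValue g F c i false true →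
        (1 + ε) * B' < (1 - ε) * B ∨ (1 + ε) * B < (1 - ε) * B') :
    Real.exp ((N : ℝ) / 16200) ≤ 60 * 3 ^ (b * (2 * k + 1)) := by
  classical
  have : Nonempty (Fin N) := ⟨⟨0, hN⟩⟩
  set base : (Fin N → Bool) → ℝ := fun y => ∑ j, blockValue g F c j false (y j) with hbase
  set T : (Fin N → Bool) → Set ℝ := fun y => Set.Icc ((1 - ε) * base y) ((1 + ε) * base y) with hT
  set S : (Fin N → Bool) → (Fin N → Bool) → List (Fin n) :=
    fun x y => firstStream e F x ++ secondStream e c y with hS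
  have hvalid : ∀ x y, S x y ∈ insertionStreams n m := by
    intro x y
    change ∑ d, id (freq (S x y) d) ≤ m
    rw [hS, sum_freq_blockStream id rfl]
    exact hm x y
  set E : (Fin N → Bool) → (Fin N → Bool) → Set Ω :=
    fun x y => {ω | A.output k ω (S x y) ∈ T y} with hE
  have hEm : ∀ x y, MeasurableSet (E x y) := fun x y =>
    A.measurable_output k (S x y) measurableSet_Icc
  have hmain := exp_le_card_of_rectangle_partition P
    (fun ω (t : Transcript k b) x => if FirstConsistent A ω t (firstStream e F x) then 1 else 0)
    (fun ω t y => if SecondConsistent A ω (∑ j, F j) t (secondStream e c y) ∧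
      A.out ω (t.2 (Fin.last k)).1 ∈ T y then 1 else 0)
    (fun _ _ _ => by positivity) (fun _ _ _ => by split_ifs <;> norm_num)
    (fun _ _ _ => by positivity) (fun _ _ _ => by split_ifs <;> norm_num) E hEm
    (fun ω x y => by
      have := indicator_output_eq_sum A ω m hb _ _ (hvalid x y) (T y)
      rw [length_firstStream] at this
      convert this) ?_ ?_
  · rw [Fintype.card_fin] at hmain
    exact hmain.trans (mul_le_mul_of_nonneg_left (card_transcript_le k b) (by norm_num))
  · intro x y hxy
    refine (hA _ (hvalid x y)).trans_eq ?_
    have : sumOn g (freq (S x y)) = base y := by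
      rw [hS, sumOn_blockStream hg]
      refine Finset.sum_congr rfl fun j _ => ?_
      have := hxy j
      cases hx : x j <;> cases hy : y j <;> simp_all
    rw [this]
    rfl
  · intro x y i hxy
    have hxi := ((hxy i).mpr rfl).1
    have hyi := ((hxy i).mpr rfl).2
    have hval : sumOn g (freq (S x y)) =
        base y + blockValue g F c i true true - blockValue g F c i false true := by
      rw [hS, sumOn_blockStream hg, hbase]
      dsimp only
      rw [← Finset.add_sum_erase _ _ (Finset.mem_univ i),
        ← Finset.add_sum_erase Finset.univ (fun j => blockValue g F c j false (y j))
          (Finset.mem_univ i), hxi, hyi]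
      have : ∑ j ∈ Finset.univ.erase i, blockValue g F c j (x j) (y j) =
          ∑ j ∈ Finset.univ.erase i, blockValue g F c j false (y j) := by
        refine Finset.sum_congr rfl fun j hj => ?_
        have h1 := hxy j
        have h2 := Finset.ne_of_mem_erase hj
        cases hx : x j <;> cases hy : y j <;> simp_all
      rw [this]
      ring
    have hcorrect := hA _ (hvalid x y)
    set B' := sumOn g (freq (S x y)) with hB'
    have hmeas : MeasurableSet {ω | (1 - ε) * B' ≤ A.output k ω (S x y) ∧
        A.output k ω (S x y) ≤ (1 + ε) * B'} :=
      A.measurable_output k (S x y)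
        (measurableSet_Icc (a := (1 - ε) * B') (b := (1 + ε) * B'))
    have hdisj : E x y ⊆ {ω | (1 - ε) * B' ≤ A.output k ω (S x y) ∧
        A.output k ω (S x y) ≤ (1 + ε) * B'}ᶜ := by
      rintro ω ⟨h1, h2⟩ ⟨h3, h4⟩
      rcases hgap y i hyi _ rfl B' hval with h | h
      · exact absurd (h1.trans h4) (not_le.mpr h)
      · exact absurd (h3.trans h2) (not_le.mpr h)
    refine (MeasureTheory.measureReal_mono hdisj).trans ?_
    rw [MeasureTheory.probReal_compl_eq_one_sub hmeas]
    linarith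

end Blocks
end Streaming

namespace Streaming
section Reduction

/-- Some `N`-element subset of `L` has at most its fair share of the total weight. -/
theorem exists_light_subset {α : Type*} [DecidableEq α] (w : α → ℝ) (L : Finset α) (N : ℕ)
    (hN : N ≤ L.card) : ∃ T ⊆ L, T.card = N ∧ L.card * ∑ d ∈ T, w d ≤ N * ∑ d ∈ L, w d := by
  induction h : L.card generalizing L with
  | zero =>
    obtain rfl : N = 0 := by omega
    exact ⟨∅, Finset.empty_subset _, rfl, by simp⟩
  | succ l ih =>
    rcases Nat.eq_or_lt_of_le hN with h' | h'
    · exact ⟨L, subset_rfl, h'.symm, by rw [h', h]⟩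
    obtain ⟨a, ha, hmax⟩ := L.exists_max_image w (Finset.card_pos.mp (by omega))
    have hcard : (L.erase a).card = l := by rw [Finset.card_erase_of_mem ha, h]; rfl
    obtain ⟨T, hT, hTc, hTw⟩ := ih (L.erase a) (by omega) hcard
    refine ⟨T, hT.trans (Finset.erase_subset _ _), hTc, ?_⟩
    rcases Nat.eq_zero_or_pos l with rfl | hl
    · obtain rfl : N = 0 := by omega
      simp [Finset.card_eq_zero.mp hTc]
    have hl' : (0 : ℝ) < l := by exact_mod_cast hl
    have hsum : ∑ d ∈ L, w d ≤ (l + 1 : ℝ) * w a := by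
      have := Finset.sum_le_card_nsmul L w (w a) hmax
      rw [h, nsmul_eq_mul] at this
      exact_mod_cast this
    have herase := Finset.add_sum_erase L w ha
    refine le_of_mul_le_mul_left ?_ hl'
    push_cast
    calc (l : ℝ) * ((l + 1) * ∑ d ∈ T, w d) = (l + 1) * (l * ∑ d ∈ T, w d) := by ring
      _ ≤ (l + 1) * (N * ∑ d ∈ L.erase a, w d) := by gcongr
      _ = N * ((l + 1) * ∑ d ∈ L, w d - (l + 1) * w a) := by rw [← herase]; ring
      _ ≤ N * ((l + 1) * ∑ d ∈ L, w d - ∑ d ∈ L, w d) := by gcongr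
      _ = l * (N * ∑ d ∈ L, w d) := by ring

variable {Ω : Type*} [MeasurableSpace Ω] {P : MeasureTheory.Measure Ω}
  [MeasureTheory.IsProbabilityMeasure P] {n m k b N : ℕ} {g : ℕ → ℝ} {ε : ℝ}

/-- The reduction for functions that decrease slowly: all frequencies are at most `2`. -/
theorem exp_le_of_mul_lt_one (hg : IsDecreasingFun g) (hg1 : 0 < g 1) (hε : 0 < ε)
    (A : Algorithm Ω n) (hA : A.IsApprox P k m g ε) (hb : A.UsesAtMost k m b) (hN : 0 < N)
    (hn : 2 * N ≤ n) (hm : 2 * N ≤ m) (hεN : 4 * ε * N < 1) :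
    Real.exp ((N : ℝ) / 16200) ≤ 60 * 3 ^ (b * (2 * k + 1)) := by
  obtain ⟨e⟩ : Nonempty (Fin N × Bool ↪ Fin n) :=
    Function.Embedding.nonempty_of_card_le (by simp; omega)
  set c : Fin N → Bool → Bool → ℕ := fun _ v w => if v = true ∧ w = true then 1 else 0 with hc
  have hff : ∀ j, blockValue g (fun _ => 1) c j false false = g 1 := fun j => by
    simp [blockValue, blockFreq, c, hg.zero]
  have htf : ∀ j, blockValue g (fun _ => 1) c j true false = g 1 := fun j => by
    simp [blockValue, blockFreq, c, hg.zero]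
  have hft : ∀ j, blockValue g (fun _ => 1) c j false true = 2 * g 1 := fun j => by
    simp [blockValue, blockFreq, c, two_mul]
  have htt : ∀ j, blockValue g (fun _ => 1) c j true true = g 2 := fun j => by
    simp [blockValue, blockFreq, c, hg.zero]
  refine exp_le_of_blocks P hg.zero hN A hA hb e (fun _ => 1) c ?_ ?_ ?_
  · intro x y
    calc ∑ j, ∑ w, blockFreq (fun _ => 1) c j (x j) (y j) w ≤ ∑ _j : Fin N, 2 := by
          refine Finset.sum_le_sum fun j _ => ?_
          cases x j <;> cases y j <;> simp [blockFreq, c]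
      _ ≤ m := by simp; omega
  · intro j
    rw [hff, htf]
  · intro y i _ B hB B' hB'
    left
    rw [htt, hft] at hB'
    have hB2 : B ≤ 2 * N * g 1 := by
      calc B = ∑ j, blockValue g (fun _ => 1) c j false (y j) := hB
        _ ≤ ∑ _j : Fin N, 2 * g 1 := by
          refine Finset.sum_le_sum fun j _ => ?_
          cases y j
          · rw [hff]; linarith
          · rw [hft]
        _ = 2 * N * g 1 := by simp; ring
    have h2 := hg.anti 1 2 le_rfl one_le_two
    have h3 : 2 * ε * B ≤ 4 * ε * N * g 1 := by
      have := mul_le_mul_of_nonneg_left hB2 hε.le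
      linarith
    have h4 := mul_lt_mul_of_pos_right hεN hg1
    have h5 : (1 + ε) * B' ≤ (1 + ε) * (B - g 1) :=
      mul_le_mul_of_nonneg_left (by linarith) (by linarith)
    have h6 := mul_pos hε hg1
    linarith

/-- The reduction from a set of items whose prescribed frequencies have small values of `g`. -/
theorem exp_le_of_light_set (hg : IsDecreasingFun g) (hε : 0 < ε) (hε1 : ε < 1)
    (A : Algorithm Ω n) (hA : A.IsApprox P k m g ε) (hb : A.UsesAtMost k m b) (hN : 0 < N)
    (hn : 2 * N ≤ n) (T : Finset (Fin n)) (hT : T.card = N) (f : Fin n → ℕ)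
    (hf : ∀ d ∈ T, 1 ≤ f d) (hgf : ∀ d ∈ T, 4 * g (f d) < g 1) (hm : 3 * ∑ d ∈ T, f d ≤ m)
    (hgT : 8 * (ε * ∑ d ∈ T, g (f d)) < (1 - ε) * g 1) :
    Real.exp ((N : ℝ) / 16200) ≤ 60 * 3 ^ (b * (2 * k + 1)) := by
  set e₀ : Fin N ≃ T := (T.equivFinOfCardEq hT).symm with he₀
  obtain ⟨e₁⟩ : Nonempty (Fin N ↪ (Tᶜ : Finset (Fin n))) :=
    Function.Embedding.nonempty_of_card_le (by simp [hT]; omega)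
  set e : Fin N × Bool ↪ Fin n :=
    ⟨fun p => if p.2 then (e₁ p.1 : Fin n) else (e₀ p.1 : Fin n), by
      have hne : ∀ i j, (e₁ i : Fin n) ≠ (e₀ j : Fin n) := fun i j h =>
        Finset.mem_compl.mp (e₁ i).2 (h ▸ (e₀ j).2)
      rintro ⟨i, _ | _⟩ ⟨j, _ | _⟩ h
      · simpa [Subtype.val_inj] using h
      · exact absurd h.symm (hne _ _)
      · exact absurd h (hne _ _)
      · simpa [Subtype.val_inj] using h⟩ with he
  set F : Fin N → ℕ := fun j => f (e₀ j) with hF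
  have hF1 : ∀ j, 1 ≤ F j := fun j => hf _ (e₀ j).2
  have hsum : ∀ {M : Type} [AddCommMonoid M] (φ : ℕ → M),
      ∑ j, φ (F j) = ∑ d ∈ T, φ (f d) := by
    intro M _ φ
    rw [← Finset.sum_coe_sort T]
    exact e₀.sum_comp fun d => φ (f d)
  set c : Fin N → Bool → Bool → ℕ := fun j v w => if v = true ∧ w = false then 1 else F j with hc
  have hff : ∀ j, blockValue g F c j false false = g (F j) + g (F j + F j) := fun j => by
    simp [blockValue, blockFreq, c]
  have htf : ∀ j, blockValue g F c j true false = g (F j + F j) + g (F j) := fun j => by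
    simp [blockValue, blockFreq, c]
  have hft : ∀ j, blockValue g F c j false true = g (F j) + g (F j + 1) := fun j => by
    simp [blockValue, blockFreq, c]
  have htt : ∀ j, blockValue g F c j true true = g (F j + F j) + g 1 := fun j => by
    simp [blockValue, blockFreq, c]
  refine exp_le_of_blocks P hg.zero hN A hA hb e F c ?_ ?_ ?_
  · intro x y
    calc ∑ j, ∑ w, blockFreq F c j (x j) (y j) w ≤ ∑ j, 3 * F j := by
          refine Finset.sum_le_sum fun j _ => ?_
          have := hF1 j
          cases x j <;> cases y j <;> simp [blockFreq, c] <;> omega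
      _ = 3 * ∑ d ∈ T, f d := by rw [← Finset.mul_sum]; exact congrArg _ (hsum id)
      _ ≤ m := hm
  · intro j
    rw [hff, htf, add_comm]
  · intro y i _ B hB B' hB'
    right
    rw [htt, hft] at hB'
    have hB2 : B ≤ 2 * ∑ d ∈ T, g (f d) := by
      calc B = ∑ j, blockValue g F c j false (y j) := hB
        _ ≤ ∑ j, 2 * g (F j) := by
          refine Finset.sum_le_sum fun j _ => ?_
          have h1 := hg.anti _ _ (hF1 j) (Nat.le_add_right (F j) (F j))
          have h2 := hg.anti _ _ (hF1 j) (Nat.le_add_right (F j) 1)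
          cases y j
          · rw [hff]; linarith
          · rw [hft]; linarith
        _ = 2 * ∑ d ∈ T, g (f d) := by rw [← Finset.mul_sum]; exact congrArg _ (hsum g)
    have h1 := hg.anti _ _ (hF1 i) (Nat.le_add_right (F i) 1)
    have h2 : 4 * g (F i) < g 1 := hgf _ (e₀ i).2
    have h3 : 0 ≤ g (F i + F i) := hg.nonneg _ (by have := hF1 i; omega)
    have h4 := mul_le_mul_of_nonneg_left hB2 hε.le
    have h5 : (1 - ε) * (B + g 1 / 2) ≤ (1 - ε) * B' :=
      mul_le_mul_of_nonneg_left (by linarith) (by linarith)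
    linarith

/-- An algorithm without memory cannot tell the empty stream from a single token. -/
theorem one_le_of_isApprox (hg : IsDecreasingFun g) (hg1 : 0 < g 1) (hε1 : ε < 1)
    (A : Algorithm Ω n) (hA : A.IsApprox P k m g ε) (hb : A.UsesAtMost k m b) (hn : 0 < n)
    (hm : 0 < m) : 1 ≤ b := by
  by_contra hb0
  obtain rfl : b = 0 := by omega
  set d : Fin n := ⟨0, hn⟩
  have hempty : ([] : List (Fin n)) ∈ insertionStreams n m := by
    simp [insertionStreams, freqVectors, freq]
  have hfreq : ∀ i, freq [d] i = if i = d then 1 else 0 := by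
    intro i
    rw [freq, List.count_singleton]
    by_cases h : i = d
    · simp [h]
    · simp [h, Ne.symm h]
  have hsingle : [d] ∈ insertionStreams n m := by
    change ∑ i, freq [d] i ≤ m
    simpa [hfreq] using Nat.succ_le_of_lt hm
  have hout : ∀ S ∈ insertionStreams n m, ∀ ω, A.output k ω S = A.out ω [] := by
    intro S hS ω
    have := (hb S hS ω).2
    rw [Algorithm.output, List.length_eq_zero_iff.mp (Nat.le_zero.mp this)]
  have h0 : sumOn g (freq ([] : List (Fin n))) = 0 := by
    simp [sumOn, supp, freq]
  have h1 : sumOn g (freq [d]) = g 1 := by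
    rw [sumOn_eq_sum hg.zero, Finset.sum_eq_single d]
    · simp [hfreq]
    · intro i _ hi
      simp [hfreq, hi, hg.zero]
    · simp
  have p0 := hA _ hempty
  have p1 := hA _ hsingle
  simp only [h0, h1, hout _ hempty, hout _ hsingle, mul_zero] at p0 p1
  have hmeas : MeasurableSet {ω | 0 ≤ A.out ω [] ∧ A.out ω [] ≤ 0} :=
    A.measurable_out [] (measurableSet_Icc (a := (0 : ℝ)) (b := 0))
  have hsub : {ω | (1 - ε) * g 1 ≤ A.out ω [] ∧ A.out ω [] ≤ (1 + ε) * g 1} ⊆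
      {ω | 0 ≤ A.out ω [] ∧ A.out ω [] ≤ 0}ᶜ := by
    rintro ω ⟨h, -⟩ ⟨-, h'⟩
    have := mul_pos (sub_pos.mpr hε1) hg1
    linarith
  have := MeasureTheory.measureReal_mono (μ := P) hsub
  rw [MeasureTheory.probReal_compl_eq_one_sub hmeas] at this
  linarith

/-- The space bound in exponential form. -/
theorem exp_floor_le (hg : IsDecreasingFun g) (hg1 : 0 < g 1) (hε : 0 < ε) {lam : ℝ}
    (hlam : 0 < lam) (hlam1 : lam ≤ 1 - ε) (A : Algorithm Ω n) (hA : A.IsApprox P k m g ε)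
    (hb : A.UsesAtMost k m b) (f : Fin n → ℕ) (hfm : ∑ d, f d ≤ m)
    (hfg : sumOn g f ≤ ε⁻¹ * g 1) :
    Real.exp ((⌊lam * (supp f).card / 64⌋₊ : ℝ) / 16200) ≤ 60 * 3 ^ (b * (2 * k + 1)) := by
  set s := (supp f).card with hs
  set N := ⌊lam * s / 64⌋₊ with hN
  rcases Nat.eq_zero_or_pos N with h0 | hpos
  · rw [h0]
    have : (1 : ℝ) ≤ 3 ^ (b * (2 * k + 1)) := one_le_pow₀ (by norm_num)
    simp only [Nat.cast_zero, zero_div, Real.exp_zero]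
    linarith
  have hNle : (N : ℝ) ≤ lam * s / 64 := Nat.floor_le (by positivity)
  have hf1 : ∀ d ∈ supp f, 1 ≤ f d := fun d hd =>
    Nat.one_le_iff_ne_zero.mpr (Finset.mem_filter.mp hd).2
  have hsn : s ≤ n := by simpa using Finset.card_le_univ (supp f)
  have hsupp_sum : ∑ d ∈ supp f, f d ≤ m :=
    (Finset.sum_le_sum_of_subset (Finset.subset_univ _)).trans hfm
  have hsm : s ≤ m := by
    refine le_trans ?_ hsupp_sum
    rw [hs, Finset.card_eq_sum_ones]
    exact Finset.sum_le_sum hf1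
  have hs0 : (0 : ℝ) ≤ s := Nat.cast_nonneg s
  have hNs : (N : ℝ) ≤ s / 64 := by
    have : lam * s ≤ 1 * s := mul_le_mul_of_nonneg_right (by linarith) hs0
    linarith
  have h2N : 2 * N ≤ s := by
    have : (2 * N : ℝ) ≤ s := by linarith
    exact_mod_cast this
  have hspos : (0 : ℝ) < s := by
    have : 0 < s := by omega
    exact_mod_cast this
  have hgf0 : ∀ d ∈ supp f, 0 ≤ g (f d) := fun d hd => hg.nonneg _ (hf1 d hd)
  have hεg : ε * ∑ d ∈ supp f, g (f d) ≤ g 1 := by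
    have := mul_le_mul_of_nonneg_left hfg hε.le
    rwa [mul_inv_cancel_left₀ hε.ne'] at this
  set L := (supp f).filter fun d => 4 * g (f d) < g 1 with hL
  have hLs : L ⊆ supp f := Finset.filter_subset _ _
  by_cases hcard : s ≤ 2 * L.card
  · have hm0 : (0 : ℝ) < m := by
      have : 0 < m := by omega
      exact_mod_cast this
    have hL0 : (0 : ℝ) < L.card := by
      have : 0 < L.card := by omega
      exact_mod_cast this
    obtain ⟨T, hTL, hTc, hTw⟩ := exists_light_subset
      (fun d => (f d : ℝ) / m + ε * g (f d) / g 1) L N (by omega)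
    simp only [Finset.sum_add_distrib, ← Finset.sum_div, ← Finset.mul_sum, ← Nat.cast_sum] at hTw
    have hTs := hTL.trans hLs
    have hLf : ((∑ d ∈ L, f d : ℕ) : ℝ) / m ≤ 1 := by
      rw [div_le_one hm0]
      exact_mod_cast (Finset.sum_le_sum_of_subset hLs).trans hsupp_sum
    have hLg : ε * ∑ d ∈ L, g (f d) / g 1 ≤ 1 := by
      rw [← Finset.sum_div, ← mul_div_assoc, div_le_one hg1]
      exact (mul_le_mul_of_nonneg_left
        (Finset.sum_le_sum_of_subset_of_nonneg hLs fun d hd _ => hgf0 d hd) hε.le).trans hεg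
    rw [← Finset.sum_div, ← mul_div_assoc] at hLg
    set a := ((∑ d ∈ T, f d : ℕ) : ℝ) / m with ha
    set q := ε * ∑ d ∈ T, g (f d) / g 1 with hq
    have hTg0 : 0 ≤ ∑ d ∈ T, g (f d) := Finset.sum_nonneg fun d hd => hgf0 d (hTs hd)
    have ha0 : 0 ≤ a := by positivity
    have hq' : q = (ε * ∑ d ∈ T, g (f d)) / g 1 := by
      rw [hq, ← Finset.sum_div, mul_div_assoc]
    have hq0 : 0 ≤ q := by rw [hq']; positivity
    have hw : a + q ≤ lam / 16 := by
      rw [← hq'] at hTw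
      have h1 : (L.card : ℝ) * (a + q) ≤ N * 2 :=
        hTw.trans (mul_le_mul_of_nonneg_left (by linarith) (Nat.cast_nonneg _))
      have h2 : (s : ℝ) ≤ 2 * L.card := by exact_mod_cast hcard
      have h3 : (s : ℝ) * (a + q) ≤ 2 * L.card * (a + q) :=
        mul_le_mul_of_nonneg_right h2 (by linarith)
      refine le_of_mul_le_mul_left ?_ hspos
      linarith
    refine exp_le_of_light_set hg hε (by linarith) A hA hb hpos (h2N.trans hsn) T hTc f
      (fun d hd => hf1 d (hTs hd)) (fun d hd => (Finset.mem_filter.mp (hTL hd)).2) ?_ ?_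
    · have h1 : a ≤ 1 / 3 := by linarith
      rw [ha, div_le_iff₀ hm0] at h1
      have h2 : (3 : ℝ) * (∑ d ∈ T, f d : ℕ) ≤ m := by linarith
      exact_mod_cast h2
    · have h1 : q ≤ lam / 16 := by linarith
      rw [hq', div_le_iff₀ hg1] at h1
      have h2 := mul_le_mul_of_nonneg_right hlam1 hg1.le
      have h3 := mul_pos hlam hg1
      linarith
  · refine exp_le_of_mul_lt_one hg hg1 hε A hA hb hpos (h2N.trans hsn) (h2N.trans hsm) ?_
    have hsplit : ((supp f \ L).card : ℝ) = s - L.card := by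
      rw [Finset.cast_card_sdiff hLs]
    have hlow : (supp f \ L).card * (g 1 / 4) ≤ ∑ d ∈ supp f, g (f d) := by
      calc (supp f \ L).card * (g 1 / 4) = ∑ _d ∈ supp f \ L, g 1 / 4 := by simp
        _ ≤ ∑ d ∈ supp f \ L, g (f d) := by
          refine Finset.sum_le_sum fun d hd => ?_
          obtain ⟨h1, h2⟩ := Finset.mem_sdiff.mp hd
          have : ¬ 4 * g (f d) < g 1 := fun h => h2 (Finset.mem_filter.mpr ⟨h1, h⟩)
          linarith
        _ ≤ _ := Finset.sum_le_sum_of_subset_of_nonneg Finset.sdiff_subset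
          fun d hd _ => hgf0 d hd
    have h1 : (2 * L.card : ℝ) ≤ s := by exact_mod_cast (not_le.mp hcard).le
    have h2 : (s : ℝ) / 2 * (g 1 / 4) ≤ (supp f \ L).card * (g 1 / 4) :=
      mul_le_mul_of_nonneg_right (by linarith) (by linarith)
    have h3 := mul_le_mul_of_nonneg_left (h2.trans hlow) hε.le
    have h4 : ε * s ≤ 8 := by
      refine le_of_mul_le_mul_right ?_ hg1
      linarith
    have h5 := mul_le_mul_of_nonneg_left hNs hε.le
    linarith

end Reduction
end Streaming

theorem theorem1 (ε₀ : ℝ) (hε₀ : ε₀ < 1) :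
    ∃ c : ℝ, 0 < c ∧
      ∀ (Ω : Type*) [MeasurableSpace Ω] (μ : MeasureTheory.Measure Ω)
        [MeasureTheory.IsProbabilityMeasure μ] (n m k : ℕ) (g : ℕ → ℝ) (ε : ℝ),
        Streaming.IsDecreasingFun g → 0 < g 1 → 0 < ε → ε ≤ ε₀ → 1 ≤ k →
        ∀ (A : Streaming.Algorithm Ω n) (b : ℕ),
          A.IsApprox μ k m g ε → A.UsesAtMost k m b →
          c * ((Streaming.sigma ε g m n : ℝ) / (k : ℝ)) ≤ (b : ℝ) := by
  refine ⟨(1 - ε₀) / 12000000, by linarith, ?_⟩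
  intro Ω _ μ _ n m k g ε hg hg1 hε hεε₀ hk A b hA hb
  obtain ⟨⟨f, hfm, hfg, hs⟩, -⟩ := Streaming.sigma_isGreatest hg hε m n
  have hk0 : (0 : ℝ) < k := by exact_mod_cast hk
  rw [← mul_div_assoc, div_le_iff₀ hk0]
  set s := Streaming.sigma ε g m n with hσ
  rcases Nat.eq_zero_or_pos s with h0 | hpos
  · rw [h0, Nat.cast_zero, mul_zero]
    positivity
  have hm0 : 0 < m := by
    obtain ⟨d, hd⟩ := Finset.card_pos.mp (hs ▸ hpos)
    have h1 : f d ≠ 0 := (Finset.mem_filter.mp hd).2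
    have h2 := Finset.single_le_sum (f := f) (fun _ _ => Nat.zero_le _) (Finset.mem_univ d)
    have h3 : ∑ d, f d ≤ m := hfm
    omega
  have hn0 : 0 < n := by
    obtain ⟨d, -⟩ := Finset.card_pos.mp (hs ▸ hpos)
    exact d.pos
  have hb1 := Streaming.one_le_of_isApprox hg hg1 (hεε₀.trans_lt hε₀) A hA hb hn0 hm0
  have hexp := Streaming.exp_floor_le hg hg1 hε (lam := 1 - ε₀) (by linarith) (by linarith)
    A hA hb f hfm hfg
  rw [hs] at hexp
  set N := ⌊(1 - ε₀) * s / 64⌋₊ with hN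
  have hfloor : (1 - ε₀) * s / 64 < N + 1 := Nat.lt_floor_add_one _
  have hbk : (1 : ℝ) ≤ b * k := by
    exact_mod_cast Nat.mul_le_mul hb1 hk
  have h60 : (60 : ℝ) ≤ Real.exp 5 := by
    have h1 : (2.7 : ℝ) ≤ Real.exp 1 := by linarith [Real.exp_one_gt_d9]
    calc (60 : ℝ) ≤ 2.7 ^ 5 := by norm_num
      _ ≤ Real.exp 1 ^ 5 := by gcongr
      _ = Real.exp 5 := by rw [← Real.exp_nat_mul]; norm_num
  have h3 : (3 : ℝ) ≤ Real.exp 2 := by linarith [Real.add_one_le_exp (2 : ℝ)]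
  have hpow : (3 : ℝ) ^ (b * (2 * k + 1)) ≤ Real.exp (6 * (b * k)) := by
    calc (3 : ℝ) ^ (b * (2 * k + 1)) ≤ 3 ^ (3 * (b * k)) := by
          refine pow_le_pow_right₀ (by norm_num) ?_
          nlinarith
      _ ≤ Real.exp 2 ^ (3 * (b * k)) := by gcongr
      _ = Real.exp (6 * (b * k)) := by
          rw [← Real.exp_nat_mul]; congr 1; push_cast; ring
  have hle : Real.exp ((N : ℝ) / 16200) ≤ Real.exp (5 + 6 * (b * k)) := by
    rw [Real.exp_add]
    exact hexp.trans (mul_le_mul h60 hpow (by positivity) (Real.exp_pos _).le)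
  have hN' := Real.exp_le_exp.mp hle
  linarith
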